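/- Let $(\Omega,\Sigma,\mu)$ be a complete probability space, let $X$ and $Y$ be real Banach spaces, and let $1\le p<\infty$. Write $B_{X^*}$ for the closed unit ball of the dual $X^*$. A function $f:\Omega\to X$ is called *$p$-Dunford integrable* if $\langle f,x^*\rangle\in L^p(\mu)$ for every $x^*\in X^*$, and then $$\|f\|_{\mathscr D_p(\mu,X)}:=\sup_{x^*\in B_{X^*}}\Big(\int_\Omega|\langle f,x^*\rangle|^p\,d\mu\Big)^{1/p}.$$ A function $g:\Omega\to Y$ is called *strongly measurable* if it is the $\mu$-almost everywhere limit, in norm, of a sequence of simple functions, and *$p$-Bochner integrable* if it is strongly measurable and $\|g(\cdot)\|_Y\in L^p(\mu)$; we write $\|g\|_{L^p(\mu,Y)}:=\big(\int_\Omega\|g(\cdot)\|_Y^p\,d\mu\big)^{1/p}$. A continuous linear map $u:X\to Y$ is called *$p$-summing* if there is a constant $K\ge 0$ such that $$\Big(\sum_{i=1}^n\|u(x_i)\|_Y^p\Big)^{1/p}\le K\,\sup_{x^*\in B_{X^*}}\Big(\sum_{i=1}^n|\langle x_i,x^*\rangle|^p\Big)^{1/p}$$ for all $n\in\mathbb N$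 and $x_1,\dots,x_n\in X$; the least such constant is denoted by $\pi_p(u)$. **Theorem.** Let $u:X\to Y$ be a $p$-summing operator and let $f:\Omega\to X$ be a $p$-Dunford integrable function such that $u\circ f$ is strongly measurable. Then $u\circ f$ is $p$-Bochner integrable and $$\|u\circ f\|_{L^p(\mu,Y)}\le\pi_p(u)\,\|f\|_{\mathscr D_p(\mu,X)}.$$ -/

import Mathlib

open MeasureTheory
open scoped NNReal ENNReal

namespace PSummingDunford

noncomputable section

/-- `f : Ω → X` is `p`-Dunford integrable: `⟨f, x*⟩ ∈ L^p(μ)` for every `x* ∈ X*`. -/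
def PDunfordIntegrable {Ω X : Type*} [MeasurableSpace Ω] [NormedAddCommGroup X] [NormedSpace ℝ X]
    (f : Ω → X) (p : ℝ≥0) (μ : Measure Ω) : Prop :=
  ∀ φ : StrongDual ℝ X, MemLp (fun ω => φ (f ω)) (p : ℝ≥0∞) μ

/-- The norm `sup_{‖x*‖ ≤ 1} (∫ |⟨f, x*⟩|^p dμ)^(1/p)`, as an element of `[0, ∞]`. -/
def dunfordNorm {Ω X : Type*} [MeasurableSpace Ω] [NormedAddCommGroup X] [NormedSpace ℝ X]
    (f : Ω → X) (p : ℝ≥0) (μ : Measure Ω) : ℝ≥0∞ :=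
  ⨆ φ ∈ Metric.closedBall (0 : StrongDual ℝ X) 1, (∫⁻ ω, ‖φ (f ω)‖ₑ ^ (p : ℝ) ∂μ) ^ (1 / (p : ℝ))

/-- `f : Ω → Y` is `p`-Bochner integrable: it is strongly measurable (an almost everywhere limit
of simple functions) and `‖f(·)‖` belongs to `L^p(μ)`. -/
def PBochnerIntegrable {Ω Y : Type*} [MeasurableSpace Ω] [NormedAddCommGroup Y]
    (f : Ω → Y) (p : ℝ≥0) (μ : Measure Ω) : Prop :=
  AEStronglyMeasurable f μ ∧ MemLp (fun ω => ‖f ω‖) (p : ℝ≥0∞) μ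

/-- The norm `(∫ ‖f‖^p dμ)^(1/p)` of `L^p(μ, Y)`, as an element of `[0, ∞]`. -/
def bochnerNorm {Ω Y : Type*} [MeasurableSpace Ω] [NormedAddCommGroup Y]
    (f : Ω → Y) (p : ℝ≥0) (μ : Measure Ω) : ℝ≥0∞ :=
  (∫⁻ ω, ‖f ω‖ₑ ^ (p : ℝ) ∂μ) ^ (1 / (p : ℝ))

/-- The constant `K ≥ 0` satisfies the `p`-summing inequality for `u`. -/
def SummingBound {X Y : Type*} [NormedAddCommGroup X] [NormedSpace ℝ X]
    [NormedAddCommGroup Y] [NormedSpace ℝ Y] (u : X →L[ℝ] Y) (p : ℝ≥0) (K : ℝ≥0) : Prop :=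
  ∀ (n : ℕ) (x : Fin n → X),
    (∑ i, ‖u (x i)‖ₑ ^ (p : ℝ)) ^ (1 / (p : ℝ)) ≤
      (K : ℝ≥0∞) * ⨆ φ ∈ Metric.closedBall (0 : StrongDual ℝ X) 1,
        (∑ i, ‖φ (x i)‖ₑ ^ (p : ℝ)) ^ (1 / (p : ℝ))

/-- `u` is `p`-summing. -/
def PSumming {X Y : Type*} [NormedAddCommGroup X] [NormedSpace ℝ X]
    [NormedAddCommGroup Y] [NormedSpace ℝ Y] (u : X →L[ℝ] Y) (p : ℝ≥0) : Prop :=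
  ∃ K : ℝ≥0, SummingBound u p K

/-- The `p`-summing norm `π_p(u)`, the least admissible constant of a `p`-summing operator. -/
def summingNorm {X Y : Type*} [NormedAddCommGroup X] [NormedSpace ℝ X]
    [NormedAddCommGroup Y] [NormedSpace ℝ Y] (u : X →L[ℝ] Y) (p : ℝ≥0) : ℝ≥0 :=
  sInf {K : ℝ≥0 | SummingBound u p K}

end

end PSummingDunford

namespace PSummingDunford

/-! On a large part of `Ω`, strong measurability gives finitely many disjoint sets `A i` on which `u
∘ f` is within `ε` of a vector `y i`; let `z i` norm `y i`. The rescaled Dunford integrals `ξ i φ =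
μ(A i)^(1/p - 1) ∫_{A i} φ(f)` lie in the bidual of `X`, not in `X`. By Hölder their weak `ℓ^p` norm
is at most the Dunford norm of `f`, which is finite by the closed graph theorem.

The heart is `norm_toLp_comp_le_of_summing`: the summing inequality survives, with the same
constant, for such functionals tested against `z i ∘ u`. A finite almost-norming set and Hahn–Banach
play the role of local reflexivity. So `∑ |ξ i (z i ∘ u)|^p` is at most `(K ‖f‖)^p`, while each term
is at least `μ(A i) (‖y i‖ - ε)^p` when `‖y i‖ ≥ ε`. Fatou's lemma then exhausts `Ω` and removes
`ε`. -/

/-! ### Duality tools. -/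

/-- The dual ball is compact, so it has a finite `δ`-net; moving a norming functional of `v` to the
net costs at most `δ ‖v‖`. -/
theorem exists_finset_almost_norming (F : Type*) [NormedAddCommGroup F] [NormedSpace ℝ F]
    [FiniteDimensional ℝ F] {δ : ℝ} (hδ : 0 < δ) :
    ∃ N : Finset (StrongDual ℝ F), (∀ a ∈ N, ‖a‖ ≤ 1) ∧
      ∀ (v : F) (r : ℝ), (∀ a ∈ N, a v ≤ r) → (1 - δ) * ‖v‖ ≤ r := by
  have : ProperSpace (StrongDual ℝ F) := FiniteDimensional.proper ℝ _
  obtain ⟨t, hts, htf, ht⟩ :=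
    (isCompact_closedBall (0 : StrongDual ℝ F) 1).finite_cover_balls hδ
  refine ⟨htf.toFinset, fun a ha => by simpa using hts (htf.mem_toFinset.1 ha), fun v r h => ?_⟩
  obtain ⟨g, hg, hgv⟩ := exists_dual_vector'' ℝ v
  have hmem : g ∈ ⋃ x ∈ t, Metric.ball x δ := ht (by simpa using hg)
  simp only [Set.mem_iUnion, Metric.mem_ball, dist_eq_norm, exists_prop] at hmem
  obtain ⟨a, hat, hag⟩ := hmem
  have h1 := h a (htf.mem_toFinset.2 hat)
  have h2 : (g - a) v ≤ δ * ‖v‖ :=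
    (le_abs_self _).trans (((g - a).le_opNorm v).trans (by gcongr))
  have h3 : g v = ‖v‖ := hgv
  rw [sub_apply, h3] at h2
  linarith

/-- A functional dominated by `‖T ·‖` factors through `T`, by the Hahn–Banach theorem. -/
theorem exists_dual_comp_eq {E F : Type*} [AddCommGroup E] [Module ℝ E]
    [NormedAddCommGroup F] [NormedSpace ℝ F] (T : E →ₗ[ℝ] F) (ψ : E →ₗ[ℝ] ℝ) {C : ℝ}
    (hC : 0 ≤ C) (h : ∀ x, |ψ x| ≤ C * ‖T x‖) :
    ∃ Ψ : StrongDual ℝ F, ‖Ψ‖ ≤ C ∧ ∀ x, Ψ (T x) = ψ x := by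
  have hker : T.ker ≤ ψ.ker := fun x hx => by
    have := h x
    rw [LinearMap.mem_ker.1 hx, norm_zero, mul_zero] at this
    exact abs_eq_zero.1 (le_antisymm this (abs_nonneg _))
  let f : T.range →ₗ[ℝ] ℝ := (T.ker.liftQ ψ hker) ∘ₗ T.quotKerEquivRange.symm.toLinearMap
  have hf : ∀ x, f ⟨T x, x, rfl⟩ = ψ x := fun x => by
    exact congrArg (T.ker.liftQ ψ hker) (T.quotKerEquivRange_symm_apply_image x ⟨x, rfl⟩)
  have hb : ∀ y, ‖f y‖ ≤ C * ‖y‖ := by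
    rintro ⟨_, x, rfl⟩
    rw [hf]
    exact h x
  obtain ⟨g, hg, hgn⟩ := exists_extension_norm_eq T.range (f.mkContinuous C hb)
  refine ⟨g, hgn ▸ f.mkContinuous_norm_le hC hb, fun x => ?_⟩
  have := hg ⟨T x, x, rfl⟩
  rw [← hf x]
  exact this

/-- Vectors almost norming each component assemble into a single vector of sup norm at most one. -/
theorem sum_norm_comp_single_le {ι X : Type*} [Fintype ι] [DecidableEq ι]
    [NormedAddCommGroup X] [NormedSpace ℝ X] (Ψ : StrongDual ℝ (ι → X)) :
    ∑ i, ‖Ψ.comp (ContinuousLinearMap.single ℝ (fun _ : ι => X) i)‖ ≤ ‖Ψ‖ := by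
  have key : ∀ η > 0, ∑ i, (‖Ψ.comp (ContinuousLinearMap.single ℝ (fun _ : ι => X) i)‖ - η)
      ≤ ‖Ψ‖ := by
    intro η hη
    have h : ∀ i, ∃ z : X, ‖z‖ ≤ 1 ∧
        ‖Ψ.comp (ContinuousLinearMap.single ℝ (fun _ : ι => X) i)‖ - η ≤ Ψ (Pi.single i z) := by
      intro i
      obtain ⟨z, hz, hz'⟩ := ContinuousLinearMap.exists_lt_apply_of_lt_opNorm
        (Ψ.comp (ContinuousLinearMap.single ℝ (fun _ : ι => X) i)) (sub_lt_self _ hη)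
      rw [Real.norm_eq_abs, lt_abs] at hz'
      rcases hz' with hz' | hz'
      · exact ⟨z, hz.le, hz'.le⟩
      · refine ⟨-z, by simpa using hz.le, ?_⟩
        rw [Pi.single_neg, map_neg]
        exact hz'.le
    choose z hz hz' using h
    calc _ ≤ ∑ i, Ψ (Pi.single i (z i)) := Finset.sum_le_sum fun i _ => hz' i
      _ = Ψ z := by rw [← map_sum, Finset.univ_sum_single]
      _ ≤ ‖Ψ‖ * ‖z‖ := (le_abs_self _).trans (Ψ.le_opNorm z)
      _ ≤ ‖Ψ‖ * 1 := by
        gcongr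
        exact (pi_norm_le_iff_of_nonneg zero_le_one).2 hz
      _ = ‖Ψ‖ := mul_one _
  by_contra! hlt
  set S := ∑ i, ‖Ψ.comp (ContinuousLinearMap.single ℝ (fun _ : ι => X) i)‖
  -- The `+ 1` keeps the total loss `card ι * η` strictly below the excess `S - ‖Ψ‖`.
  have hη : 0 < (S - ‖Ψ‖) / (Fintype.card ι + 1) := div_pos (by linarith) (by positivity)
  have := key _ hη
  rw [Finset.sum_sub_distrib, Finset.sum_const, Finset.card_univ, nsmul_eq_mul] at this
  have h2 : (Fintype.card ι + 1 : ℝ) * ((S - ‖Ψ‖) / (Fintype.card ι + 1)) = S - ‖Ψ‖ := by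
    field_simp
  change S - _ ≤ _ at this
  linarith

/-! ### Extension of the summing inequality to the bidual. -/

/-- The summing inequality passes from tuples in `X` to tuples of functionals on the dual of `X`. -/
theorem norm_toLp_comp_le_of_summing {ι X Y : Type*} [Fintype ι]
    [NormedAddCommGroup X] [NormedSpace ℝ X] [NormedAddCommGroup Y] [NormedSpace ℝ Y]
    {q : ℝ≥0∞} [Fact (1 ≤ q)] (u : X →L[ℝ] Y) {K : ℝ} (hK : 0 ≤ K) (y : ι → StrongDual ℝ Y)
    (hu : ∀ (x : ι → X) (S : ℝ), 0 ≤ S →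
      (∀ φ : StrongDual ℝ X, ‖φ‖ ≤ 1 → ‖WithLp.toLp q (fun i => φ (x i))‖ ≤ S) →
      ‖WithLp.toLp q (fun i => y i (u (x i)))‖ ≤ K * S)
    (ξ : ι → StrongDual ℝ X →ₗ[ℝ] ℝ) {M : ℝ} (hM : 0 ≤ M)
    (hξ : ∀ φ, ‖WithLp.toLp q (fun i => ξ i φ)‖ ≤ M * ‖φ‖) :
    ‖WithLp.toLp q (fun i => ξ i ((y i).comp u))‖ ≤ K * M := by
  classical
  set v : PiLp q (fun _ : ι => ℝ) := WithLp.toLp q (fun i => ξ i ((y i).comp u)) with hv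
  have key : ∀ δ, 0 < δ → δ < 1 → (1 - δ) * ‖v‖ ≤ K * M := by
    intro δ hδ hδ1
    have hδ' : 0 < 1 - δ := by linarith
    obtain ⟨N, hN, hN'⟩ := exists_finset_almost_norming (PiLp q (fun _ : ι => ℝ)) hδ
    have hsum : ∀ (a : StrongDual ℝ (PiLp q (fun _ : ι => ℝ))) (w : ι → ℝ),
        a (WithLp.toLp q w) = ∑ i, w i * a (PiLp.basisFun q ℝ ι i) := by
      intro a w
      conv_lhs => rw [← (PiLp.basisFun q ℝ ι).sum_repr (WithLp.toLp q w)]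
      simp
    obtain ⟨L, hL, hLv⟩ := exists_dual_vector'' ℝ v
    let e : ι → PiLp q (fun _ : ι => ℝ) := fun i => PiLp.basisFun q ℝ ι i
    -- Since `N` almost norms `ℓ^q`, the weak `ℓ^q` norm of `x` is at most `‖T x‖ / (1 - δ)`; the
    -- summing inequality thus dominates `ψ` by `‖T ·‖`.
    let T : (ι → X) →ₗ[ℝ] (N → X) :=
      LinearMap.pi fun a => ∑ i, (a : StrongDual ℝ _) (e i) • LinearMap.proj i
    let ψ : (ι → X) →ₗ[ℝ] ℝ :=
      ∑ i, L (e i) • ((y i).comp u).toLinearMap ∘ₗ LinearMap.proj i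
    have hT : ∀ x a, T x a = ∑ i, (a : StrongDual ℝ _) (e i) • x i := fun x a => by simp [T]
    have hψ : ∀ x, ψ x = L (WithLp.toLp q (fun i => y i (u (x i)))) := fun x => by
      rw [hsum]
      simp [ψ, e, mul_comm]
    obtain ⟨Ψ, hΨ, hΨT⟩ := exists_dual_comp_eq T ψ (C := K / (1 - δ)) (by positivity) fun x => by
      have h1 : ‖WithLp.toLp q (fun i => y i (u (x i)))‖ ≤ K * (‖T x‖ / (1 - δ)) := by
        refine hu x _ (by positivity) fun φ hφ => ?_
        rw [le_div_iff₀ hδ', mul_comm]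
        refine hN' _ _ fun a ha => ?_
        calc a (WithLp.toLp q fun i => φ (x i)) = φ (T x ⟨a, ha⟩) := by
              rw [hsum, hT, map_sum]
              simp [e, mul_comm]
          _ ≤ ‖φ‖ * ‖T x ⟨a, ha⟩‖ := (le_abs_self _).trans (φ.le_opNorm _)
          _ ≤ 1 * ‖T x‖ := by
            gcongr
            exact norm_le_pi_norm (T x) _
          _ = ‖T x‖ := one_mul _
      rw [hψ, div_mul_eq_mul_div, mul_div_assoc]
      calc _ ≤ ‖L‖ * _ := L.le_opNorm _
        _ ≤ 1 * (K * (‖T x‖ / (1 - δ))) := by gcongr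
        _ = _ := one_mul _
    let Ψ' : N → StrongDual ℝ X := fun a =>
      Ψ.comp (ContinuousLinearMap.single ℝ (fun _ : N => X) a)
    -- The factorization `ψ = Ψ ∘ T`, read coordinatewise, is a finite identity in the dual of `X`,
    -- to which the linear maps `ξ i` can be applied.
    have hcomp : ∀ i, L (e i) • (y i).comp u = ∑ a : N, (a : StrongDual ℝ _) (e i) • Ψ' a := by
      intro i
      ext x
      have h1 : ψ (Pi.single i x) = L (e i) * y i (u x) := by
        simp only [ψ, LinearMap.sum_apply, LinearMap.smul_apply, LinearMap.comp_apply,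
          LinearMap.proj_apply]
        rw [Finset.sum_eq_single i]
        · simp
        · intro j _ hj
          simp [hj]
        · simp
      have h2 : T (Pi.single i x) =
          ∑ a : N, Pi.single a ((a : StrongDual ℝ _) (e i) • x) := by
        rw [Finset.univ_sum_single]
        ext a
        rw [hT, Finset.sum_eq_single i]
        · simp
        · intro j _ hj
          simp [hj]
        · simp
      have h3 := hΨT (Pi.single i x)
      rw [h1, h2, map_sum] at h3
      rw [smul_apply, sum_apply]
      simp only [smul_eq_mul, ContinuousLinearMap.comp_apply]
      rw [← h3]
      refine Finset.sum_congr rfl fun a _ => ?_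
      rw [Pi.single_smul, map_smul]
      rfl
    have hLv' : ‖v‖ = ∑ a : N, (a : StrongDual ℝ _) (WithLp.toLp q (fun i => ξ i (Ψ' a))) := by
      calc ‖v‖ = L v := hLv.symm
        _ = ∑ i, ξ i (L (e i) • (y i).comp u) := by
          rw [hv, hsum]
          simp [e, mul_comm]
        _ = ∑ i, ∑ a : N, (a : StrongDual ℝ _) (e i) * ξ i (Ψ' a) := by
          simp only [hcomp, map_sum, map_smul, smul_eq_mul]
        _ = _ := by
          rw [Finset.sum_comm]
          refine Finset.sum_congr rfl fun a _ => ?_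
          rw [hsum]
          simp [e, mul_comm]
    have hle : ‖v‖ ≤ M * (K / (1 - δ)) := by
      rw [hLv']
      calc _ ≤ ∑ a : N, M * ‖Ψ' a‖ := Finset.sum_le_sum fun a _ => by
            calc _ ≤ ‖(a : StrongDual ℝ (PiLp q (fun _ : ι => ℝ)))‖ * _ := (le_abs_self _).trans
                    ((a : StrongDual ℝ (PiLp q (fun _ : ι => ℝ))).le_opNorm _)
              _ ≤ 1 * (M * ‖Ψ' a‖) :=
                mul_le_mul (hN a a.2) (hξ _) (norm_nonneg _) zero_le_one
              _ = _ := one_mul _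
        _ = M * ∑ a : N, ‖Ψ' a‖ := by rw [Finset.mul_sum]
        _ ≤ M * (K / (1 - δ)) := by
          gcongr
          exact (sum_norm_comp_single_le Ψ).trans hΨ
    calc (1 - δ) * ‖v‖ ≤ (1 - δ) * (M * (K / (1 - δ))) := by gcongr
      _ = K * M := by field_simp
  by_contra! hlt
  have hvpos : 0 < ‖v‖ := (mul_nonneg hK hM).trans_lt hlt
  -- For this `δ`, `(1 - δ) ‖v‖` is the midpoint of `K * M` and `‖v‖`.
  have h := key ((‖v‖ - K * M) / (2 * ‖v‖)) (div_pos (by linarith) (by positivity))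
    ((div_lt_one (by positivity)).2 (by nlinarith [mul_nonneg hK hM]))
  rw [sub_mul, one_mul] at h
  have : (‖v‖ - K * M) / (2 * ‖v‖) * ‖v‖ = (‖v‖ - K * M) / 2 := by field_simp
  linarith

theorem enorm_toLp_eq_sum {ι : Type*} [Fintype ι] {p : ℝ≥0} [Fact (1 ≤ (p : ℝ≥0∞))] (w : ι → ℝ) :
    ‖WithLp.toLp (p : ℝ≥0∞) w‖ₑ = (∑ i, ‖w i‖ₑ ^ (p : ℝ)) ^ (1 / (p : ℝ)) := by
  rw [enorm_eq_nnnorm, PiLp.nnnorm_eq_sum ENNReal.coe_ne_top, ENNReal.coe_toReal,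
    ENNReal.coe_rpow_of_nonneg _ (by positivity), ENNReal.ofNNReal_finsetSum]
  simp only [ENNReal.coe_rpow_of_nonneg _ (NNReal.coe_nonneg p)]
  rfl

theorem SummingBound.norm_toLp_le {ι X Y : Type*} [Fintype ι]
    [NormedAddCommGroup X] [NormedSpace ℝ X] [NormedAddCommGroup Y] [NormedSpace ℝ Y]
    {p : ℝ≥0} [Fact (1 ≤ (p : ℝ≥0∞))] {u : X →L[ℝ] Y} {K : ℝ≥0} (hu : SummingBound u p K)
    {y : ι → StrongDual ℝ Y} (hy : ∀ i, ‖y i‖ ≤ 1) (x : ι → X) {S : ℝ} (hS : 0 ≤ S)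
    (h : ∀ φ : StrongDual ℝ X, ‖φ‖ ≤ 1 → ‖WithLp.toLp (p : ℝ≥0∞) (fun i => φ (x i))‖ ≤ S) :
    ‖WithLp.toLp (p : ℝ≥0∞) (fun i => y i (u (x i)))‖ ≤ K * S := by
  have hsum : ∀ g : ι → ℝ≥0∞, ∑ j, g ((Fintype.equivFin ι).symm j) = ∑ i, g i := fun g =>
    Equiv.sum_comp _ g
  have h1 := hu (Fintype.card ι) (fun j => x ((Fintype.equivFin ι).symm j))
  rw [hsum (fun i => ‖u (x i)‖ₑ ^ (p : ℝ))] at h1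
  have h2 : ‖WithLp.toLp (p : ℝ≥0∞) (fun i => y i (u (x i)))‖ₑ ≤ K * ENNReal.ofReal S := by
    rw [enorm_toLp_eq_sum]
    refine le_trans ?_ (h1.trans ?_)
    · gcongr with i
      refine ((y i).le_opENorm _).trans ?_
      calc _ ≤ 1 * ‖u (x i)‖ₑ := by
            gcongr
            rw [← ofReal_norm, ← ENNReal.ofReal_one]
            exact ENNReal.ofReal_le_ofReal (hy i)
        _ = _ := one_mul _
    · gcongr
      refine iSup₂_le fun φ hφ => ?_
      rw [hsum (fun i => ‖φ (x i)‖ₑ ^ (p : ℝ)), ← enorm_toLp_eq_sum, ← ofReal_norm]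
      exact ENNReal.ofReal_le_ofReal (h φ (by simpa using hφ))
  rwa [← ENNReal.ofReal_le_ofReal_iff (by positivity), ofReal_norm,
    ENNReal.ofReal_mul K.coe_nonneg, ENNReal.ofReal_coe_nnreal]

/-! ### Averages over sets and finiteness of the Dunford norm. -/

section Integrals

variable {Ω : Type*} [MeasurableSpace Ω] {μ : Measure Ω}

theorem eLpNorm_coe_eq {E : Type*} [NormedAddCommGroup E] {p : ℝ≥0} (hp : 1 ≤ p) (h : Ω → E) :
    eLpNorm h p μ = (∫⁻ ω, ‖h ω‖ₑ ^ (p : ℝ) ∂μ) ^ (1 / (p : ℝ)) := by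
  rw [eLpNorm_eq_lintegral_rpow_enorm_toReal _ ENNReal.coe_ne_top, ENNReal.coe_toReal]
  exact ENNReal.coe_ne_zero.2 (zero_lt_one.trans_le hp).ne'

/-- Hölder on `A` produces the factor `μ(A)^(1 - 1/p)`, which the weight cancels. -/
theorem enorm_rpow_mul_setIntegral_rpow_le [IsFiniteMeasure μ] {p : ℝ≥0} (hp : 1 ≤ p)
    {h : Ω → ℝ} (hh : AEStronglyMeasurable h μ) (A : Set Ω) :
    ‖μ.real A ^ (1 / (p : ℝ) - 1) * ∫ ω in A, h ω ∂μ‖ₑ ^ (p : ℝ) ≤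
      ∫⁻ ω in A, ‖h ω‖ₑ ^ (p : ℝ) ∂μ := by
  have hp0 : 0 < (p : ℝ) := zero_lt_one.trans_le hp
  rcases eq_or_ne (μ A) 0 with hA | hA
  · rw [Measure.restrict_eq_zero.2 hA]
    simp [hp0]
  have hA' : μ A ≠ ∞ := measure_ne_top μ A
  have hreal : 0 < μ.real A := ENNReal.toReal_pos hA hA'
  have h1 : ‖∫ ω in A, h ω ∂μ‖ₑ ≤ eLpNorm h p (μ.restrict A) * μ A ^ (1 - 1 / (p : ℝ)) := by
    refine (enorm_integral_le_lintegral_enorm _).trans ?_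
    rw [← eLpNorm_one_eq_lintegral_enorm]
    have := eLpNorm_le_eLpNorm_mul_rpow_measure_univ (μ := μ.restrict A) (f := h)
      (p := 1) (q := p) (by exact_mod_cast hp) hh.restrict
    simpa using this
  have h2 : ‖μ.real A ^ (1 / (p : ℝ) - 1)‖ₑ = μ A ^ (1 / (p : ℝ) - 1) := by
    rw [Real.enorm_eq_ofReal (by positivity), ← ENNReal.ofReal_rpow_of_pos hreal,
      ofReal_measureReal]
  calc _ ≤ (eLpNorm h p (μ.restrict A)) ^ (p : ℝ) := by
        gcongr
        rw [enorm_mul, h2]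
        calc _ ≤ μ A ^ (1 / (p : ℝ) - 1) *
              (eLpNorm h p (μ.restrict A) * μ A ^ (1 - 1 / (p : ℝ))) := by gcongr
          _ = eLpNorm h p (μ.restrict A) *
              (μ A ^ (1 / (p : ℝ) - 1) * μ A ^ (1 - 1 / (p : ℝ))) := by ring
          _ = _ := by
            rw [← ENNReal.rpow_add _ _ hA hA']
            simp
    _ = _ := by
      rw [eLpNorm_coe_eq hp, ← ENNReal.rpow_mul, one_div, inv_mul_cancel₀ hp0.ne',
        ENNReal.rpow_one]

theorem measure_mul_rpow_le_enorm_rpow_mul_setIntegral [IsFiniteMeasure μ] {p : ℝ≥0} (hp : 1 ≤ p)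
    {h : Ω → ℝ} {A : Set Ω} (hA : MeasurableSet A) (hh : IntegrableOn h A μ) {c : ℝ}
    (hle : ∀ᵐ ω ∂μ, ω ∈ A → c ≤ h ω) :
    μ A * ENNReal.ofReal c ^ (p : ℝ) ≤
      ‖μ.real A ^ (1 / (p : ℝ) - 1) * ∫ ω in A, h ω ∂μ‖ₑ ^ (p : ℝ) := by
  have hp0 : 0 < (p : ℝ) := zero_lt_one.trans_le hp
  rcases eq_or_ne (μ A) 0 with hA0 | hA0
  · simp [hA0]
  have hreal : 0 < μ.real A := ENNReal.toReal_pos hA0 (measure_ne_top μ A)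
  have h1 : μ.real A * c ≤ ∫ ω in A, h ω ∂μ := by
    have := setIntegral_mono_on_ae (μ := μ) (f := fun _ => c) (g := h)
      (integrableOn_const (measure_ne_top μ A)) hh hA hle
    simpa using this
  have h2 : μ.real A ^ (1 / (p : ℝ)) * c ≤
      μ.real A ^ (1 / (p : ℝ) - 1) * ∫ ω in A, h ω ∂μ := by
    calc _ = μ.real A ^ (1 / (p : ℝ) - 1) * (μ.real A * c) := by
          rw [Real.rpow_sub_one hreal.ne']
          field_simp
      _ ≤ _ := by gcongr
  calc μ A * ENNReal.ofReal c ^ (p : ℝ)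
      = ENNReal.ofReal (μ.real A ^ (1 / (p : ℝ)) * c) ^ (p : ℝ) := by
        rw [ENNReal.ofReal_mul (by positivity), ENNReal.mul_rpow_of_nonneg _ _ hp0.le,
          ← ENNReal.ofReal_rpow_of_pos hreal, ofReal_measureReal, ← ENNReal.rpow_mul, one_div,
          inv_mul_cancel₀ hp0.ne', ENNReal.rpow_one]
    _ ≤ _ := by
      gcongr
      rw [← ofReal_norm]
      exact ENNReal.ofReal_le_ofReal (h2.trans (le_abs_self _))

variable {X : Type*} [NormedAddCommGroup X] [NormedSpace ℝ X] {p : ℝ≥0} {f : Ω → X}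

theorem eLpNorm_le_dunfordNorm (hp : 1 ≤ p) {φ : StrongDual ℝ X} (hφ : ‖φ‖ ≤ 1) :
    eLpNorm (fun ω => φ (f ω)) p μ ≤ dunfordNorm f p μ := by
  rw [eLpNorm_coe_eq hp]
  exact le_iSup₂_of_le φ (by simpa using hφ) le_rfl

theorem eLpNorm_le_enorm_mul_dunfordNorm (hp : 1 ≤ p) (φ : StrongDual ℝ X) :
    eLpNorm (fun ω => φ (f ω)) p μ ≤ ‖φ‖ₑ * dunfordNorm f p μ := by
  rcases eq_or_ne φ 0 with rfl | hφ
  · simp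
  have h0 : ‖φ‖ ≠ 0 := norm_ne_zero_iff.2 hφ
  have h1 : (fun ω => φ (f ω)) = ‖φ‖ • fun ω => (‖φ‖⁻¹ • φ) (f ω) := by
    ext ω
    simp [h0]
  rw [h1, eLpNorm_const_smul, enorm_norm]
  gcongr
  exact eLpNorm_le_dunfordNorm hp (by simp [norm_smul, h0])

/-- The map `φ ↦ φ ∘ f` into `L^p` has closed graph: an `L^p` limit is an a.e. limit along a
subsequence, and norm convergence of functionals fixes that limit pointwise. -/
theorem PDunfordIntegrable.dunfordNorm_ne_top (hp : 1 ≤ p) (hf : PDunfordIntegrable f p μ) :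
    dunfordNorm f p μ ≠ ∞ := by
  have : Fact (1 ≤ (p : ℝ≥0∞)) := ⟨by exact_mod_cast hp⟩
  let g : StrongDual ℝ X →ₗ[ℝ] Lp ℝ (p : ℝ≥0∞) μ :=
    { toFun := fun φ => (hf φ).toLp _
      map_add' := fun φ ψ => MemLp.toLp_add (hf φ) (hf ψ)
      map_smul' := fun c φ => MemLp.toLp_const_smul c (hf φ) }
  have hg : Continuous g := by
    refine LinearMap.continuous_of_seq_closed_graph g fun v φ h hv hgv => ?_
    obtain ⟨ns, hns, hae⟩ := (tendstoInMeasure_of_tendsto_Lp hgv).exists_seq_tendsto_ae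
    have hall : ∀ᵐ ω ∂μ, ∀ n, (g (v n)) ω = v n (f ω) :=
      ae_all_iff.2 fun n => (hf (v n)).coeFn_toLp
    refine Lp.ext ?_
    filter_upwards [hae, hall, (hf φ).coeFn_toLp] with ω h1 h2 h3
    refine (tendsto_nhds_unique h1 ?_).trans h3.symm
    simp only [Function.comp_apply, h2]
    exact ((ContinuousLinearMap.apply ℝ ℝ (f ω)).continuous.tendsto φ).comp
      (hv.comp hns.tendsto_atTop)
  let G : StrongDual ℝ X →L[ℝ] Lp ℝ (p : ℝ≥0∞) μ := ⟨g, hg⟩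
  refine ne_top_of_le_ne_top (ENNReal.ofReal_ne_top (r := ‖G‖)) (iSup₂_le fun φ hφ => ?_)
  rw [← eLpNorm_coe_eq hp (fun ω => φ (f ω)), ← ENNReal.ofReal_toReal (hf φ).2.ne,
    ← Lp.norm_toLp _ (hf φ)]
  refine ENNReal.ofReal_le_ofReal ((G.le_opNorm φ).trans ?_)
  exact mul_le_of_le_one_right (norm_nonneg _) (by simpa using hφ)

/-! ### Approximation of `u ∘ f` by simple functions. -/

variable {Y : Type*} [NormedAddCommGroup Y] [NormedSpace ℝ Y] {u : X →L[ℝ] Y} {K : ℝ≥0}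

theorem sum_enorm_rpow_mul_setIntegral_le [IsFiniteMeasure μ] (hp : 1 ≤ p)
    (hu : SummingBound u p K) (hf : PDunfordIntegrable f p μ) {ι : Type*} [Fintype ι]
    {A : ι → Set Ω} (hA : ∀ i, MeasurableSet (A i)) (hd : Pairwise (Function.onFun Disjoint A))
    {y : ι → StrongDual ℝ Y} (hy : ∀ i, ‖y i‖ ≤ 1) :
    ∑ i, ‖μ.real (A i) ^ (1 / (p : ℝ) - 1) * ∫ ω in A i, y i (u (f ω)) ∂μ‖ₑ ^ (p : ℝ) ≤
      (K * dunfordNorm f p μ) ^ (p : ℝ) := by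
  have hp0 : 0 < (p : ℝ) := zero_lt_one.trans_le hp
  have hp1 : Fact (1 ≤ (p : ℝ≥0∞)) := ⟨by exact_mod_cast hp⟩
  have hint : ∀ φ : StrongDual ℝ X, Integrable (fun ω => φ (f ω)) μ := fun φ =>
    (hf φ).integrable hp1.out
  let ξ : ι → StrongDual ℝ X →ₗ[ℝ] ℝ := fun i =>
    { toFun := fun φ => μ.real (A i) ^ (1 / (p : ℝ) - 1) * ∫ ω in A i, φ (f ω) ∂μ
      map_add' := fun φ ψ => by
        simp only [add_apply]
        rw [integral_add (hint φ).integrableOn (hint ψ).integrableOn, mul_add]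
      map_smul' := fun c φ => by
        simp only [smul_apply, smul_eq_mul, integral_const_mul, RingHom.id_apply]
        ring }
  have hD := hf.dunfordNorm_ne_top hp
  have hξ : ∀ φ, ‖WithLp.toLp (p : ℝ≥0∞) (fun i => ξ i φ)‖ ≤ (dunfordNorm f p μ).toReal * ‖φ‖ := by
    intro φ
    rw [← ENNReal.ofReal_le_ofReal_iff (by positivity), ofReal_norm,
      ENNReal.ofReal_mul ENNReal.toReal_nonneg, ENNReal.ofReal_toReal hD, ofReal_norm, mul_comm]
    refine le_trans ?_ (eLpNorm_le_enorm_mul_dunfordNorm hp φ)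
    rw [enorm_toLp_eq_sum, eLpNorm_coe_eq hp]
    gcongr
    calc _ ≤ ∑ i, ∫⁻ ω in A i, ‖φ (f ω)‖ₑ ^ (p : ℝ) ∂μ := Finset.sum_le_sum fun i _ =>
          enorm_rpow_mul_setIntegral_rpow_le hp (hf φ).1 (A i)
      _ = ∫⁻ ω in ⋃ i, A i, ‖φ (f ω)‖ₑ ^ (p : ℝ) ∂μ := by
        rw [lintegral_iUnion hA hd, tsum_fintype]
      _ ≤ _ := setLIntegral_le_lintegral _ _
  have hmain := norm_toLp_comp_le_of_summing (q := (p : ℝ≥0∞)) u K.coe_nonneg y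
    (fun x S hS h => hu.norm_toLp_le hy x hS h) ξ ENNReal.toReal_nonneg hξ
  rw [← ENNReal.ofReal_le_ofReal_iff (by positivity), ofReal_norm,
      ENNReal.ofReal_mul K.coe_nonneg, ENNReal.ofReal_toReal hD, ENNReal.ofReal_coe_nnreal,
      enorm_toLp_eq_sum, one_div, ENNReal.rpow_inv_le_iff hp0] at hmain
  exact hmain

/-- One `ε` pays for replacing `‖u (f ω)‖` by `‖y i‖`, the other for the lower bound `‖y i‖ - ε` on
`z i (u (f ω))`. -/
theorem setLIntegral_enorm_sub_rpow_le [IsFiniteMeasure μ] (hp : 1 ≤ p)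
    (hu : SummingBound u p K) (hf : PDunfordIntegrable f p μ) {ι : Type*} [Fintype ι]
    {A : ι → Set Ω} (hA : ∀ i, MeasurableSet (A i)) (hd : Pairwise (Function.onFun Disjoint A))
    {ε : ℝ} (y : ι → Y) (hy : ∀ i, ∀ᵐ ω ∂μ, ω ∈ A i → ‖y i - u (f ω)‖ ≤ ε) :
    ∫⁻ ω in ⋃ i, A i, ENNReal.ofReal (‖u (f ω)‖ - 2 * ε) ^ (p : ℝ) ∂μ ≤
      (K * dunfordNorm f p μ) ^ (p : ℝ) := by
  have hp0 : 0 < (p : ℝ) := zero_lt_one.trans_le hp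
  have hp1 : 1 ≤ (p : ℝ≥0∞) := by exact_mod_cast hp
  choose z hz hzy using fun i => exists_dual_vector'' ℝ (y i)
  refine le_trans ?_ (sum_enorm_rpow_mul_setIntegral_le hp hu hf hA hd hz)
  rw [lintegral_iUnion hA hd, tsum_fintype]
  refine Finset.sum_le_sum fun i _ => ?_
  have hup : ∀ᵐ ω ∂μ, ω ∈ A i → ENNReal.ofReal (‖u (f ω)‖ - 2 * ε) ^ (p : ℝ) ≤
      ENNReal.ofReal (‖y i‖ - ε) ^ (p : ℝ) := by
    filter_upwards [hy i] with ω h hω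
    have h1 := norm_le_norm_add_norm_sub (y i) (u (f ω))
    have h2 : ‖u (f ω)‖ - 2 * ε ≤ ‖y i‖ - ε := by linarith [h hω]
    gcongr
  have hle : ∫⁻ ω in A i, ENNReal.ofReal (‖u (f ω)‖ - 2 * ε) ^ (p : ℝ) ∂μ ≤
      μ (A i) * ENNReal.ofReal (‖y i‖ - ε) ^ (p : ℝ) := by
    calc _ ≤ ∫⁻ _ in A i, ENNReal.ofReal (‖y i‖ - ε) ^ (p : ℝ) ∂μ :=
          setLIntegral_mono_ae' (hA i) hup
      _ = _ := by rw [setLIntegral_const, mul_comm]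
  refine hle.trans ?_
  rcases le_total (‖y i‖ - ε) 0 with h0 | h0
  · simp [ENNReal.ofReal_of_nonpos h0, hp0]
  refine measure_mul_rpow_le_enorm_rpow_mul_setIntegral hp (hA i)
    (((hf ((z i).comp u)).integrable hp1).integrableOn) ?_
  filter_upwards [hy i] with ω h hω
  have h1 : z i (y i) = ‖y i‖ := hzy i
  have h2 : z i (y i - u (f ω)) ≤ ε := (le_abs_self _).trans
    (((z i).le_opNorm _).trans ((mul_le_of_le_one_left (norm_nonneg _) (hz i)).trans (h hω)))
  rw [map_sub, h1] at h2
  rw [ContinuousLinearMap.comp_apply]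
  linarith

theorem lintegral_enorm_rpow_le [IsFiniteMeasure μ] (hp : 1 ≤ p)
    (hu : SummingBound u p K) (hf : PDunfordIntegrable f p μ)
    (huf : AEStronglyMeasurable (fun ω => u (f ω)) μ) :
    ∫⁻ ω, ‖u (f ω)‖ₑ ^ (p : ℝ) ∂μ ≤ (K * dunfordNorm f p μ) ^ (p : ℝ) := by
  set B := (K * dunfordNorm f p μ) ^ (p : ℝ)
  set g := huf.mk with hg
  have hgm : StronglyMeasurable g := huf.stronglyMeasurable_mk
  have hge : ∀ᵐ ω ∂μ, u (f ω) = g ω := huf.ae_eq_mk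
  have hmeas : ∀ c : ℝ, Measurable fun ω => ENNReal.ofReal (‖g ω‖ - c) ^ (p : ℝ) := fun c =>
    ((hgm.norm.measurable.sub_const c).ennreal_ofReal).pow_const _
  have step : ∀ ε : ℝ, 0 < ε → ∫⁻ ω, ENNReal.ofReal (‖g ω‖ - 2 * ε) ^ (p : ℝ) ∂μ ≤ B := by
    intro ε hε
    let E : ℕ → Set Ω := fun n => {ω | ‖hgm.approx n ω - g ω‖ ≤ ε}
    have hE : ∀ n, MeasurableSet (E n) := fun n =>
      (((hgm.approx n).stronglyMeasurable.sub hgm).norm.measurable) measurableSet_Iic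
    have hEn : ∀ n, ∫⁻ ω in E n, ENNReal.ofReal (‖g ω‖ - 2 * ε) ^ (p : ℝ) ∂μ ≤ B := by
      intro n
      let A : (hgm.approx n).range → Set Ω := fun y => hgm.approx n ⁻¹' {(y : Y)} ∩ E n
      have hU : ⋃ y, A y = E n := by
        ext ω
        simp only [A, Set.mem_iUnion, Set.mem_inter_iff, Set.mem_preimage, Set.mem_singleton_iff]
        exact ⟨fun ⟨_, h⟩ => h.2,
          fun h => ⟨⟨_, (hgm.approx n).mem_range_self ω⟩, rfl, h⟩⟩
      have hd : Pairwise (Function.onFun Disjoint A) := fun y y' hne =>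
        Set.disjoint_left.2 fun ω h h' => hne (Subtype.ext (h.1.symm.trans h'.1))
      have := setLIntegral_enorm_sub_rpow_le (ε := ε) hp hu hf (A := A)
        (fun y => ((hgm.approx n).measurableSet_fiber y).inter (hE n)) hd (fun y => (y : Y))
        (fun y => by
          filter_upwards [hge] with ω h hω
          rw [h, ← hω.1]
          exact hω.2)
      change ∫⁻ ω in ⋃ y, A y, _ ∂μ ≤ B at this
      rw [hU] at this
      refine (lintegral_congr_ae (ae_restrict_of_ae ?_)).trans_le this
      filter_upwards [hge] with ω h
      rw [h]
    -- Each point lies in `E n` for all large `n`, but the sets need not increase, hence Fatou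
    -- instead of monotone convergence.
    calc ∫⁻ ω, ENNReal.ofReal (‖g ω‖ - 2 * ε) ^ (p : ℝ) ∂μ
        = ∫⁻ ω, Filter.liminf (fun n => (E n).indicator
            (fun ω => ENNReal.ofReal (‖g ω‖ - 2 * ε) ^ (p : ℝ)) ω) Filter.atTop ∂μ := by
          refine lintegral_congr fun ω => (Filter.Tendsto.liminf_eq ?_).symm
          refine tendsto_const_nhds.congr' ?_
          have h1 := tendsto_iff_norm_sub_tendsto_zero.1 (hgm.tendsto_approx ω)
          filter_upwards [h1.eventually_le_const hε] with n hn
          exact (Set.indicator_of_mem (s := E n) hn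
            fun ω => ENNReal.ofReal (‖g ω‖ - 2 * ε) ^ (p : ℝ)).symm
      _ ≤ Filter.liminf (fun n => ∫⁻ ω, (E n).indicator
            (fun ω => ENNReal.ofReal (‖g ω‖ - 2 * ε) ^ (p : ℝ)) ω ∂μ) Filter.atTop :=
          lintegral_liminf_le fun n => (hmeas _).indicator (hE n)
      _ ≤ Filter.liminf (fun _ : ℕ => B) Filter.atTop := by
          refine Filter.liminf_le_liminf (Filter.Eventually.of_forall fun n => ?_)
          rw [lintegral_indicator (hE n)]
          exact hEn n
      _ = B := Filter.liminf_const B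
  calc ∫⁻ ω, ‖u (f ω)‖ₑ ^ (p : ℝ) ∂μ = ∫⁻ ω, ‖g ω‖ₑ ^ (p : ℝ) ∂μ := by
        refine lintegral_congr_ae ?_
        filter_upwards [hge] with ω h
        rw [h]
    _ = ∫⁻ ω, Filter.liminf (fun n : ℕ =>
          ENNReal.ofReal (‖g ω‖ - 2 * (1 / ((n : ℝ) + 1))) ^ (p : ℝ)) Filter.atTop ∂μ := by
        refine lintegral_congr fun ω => (Filter.Tendsto.liminf_eq ?_).symm
        refine Filter.Tendsto.ennrpow_const _ ?_
        rw [← ofReal_norm]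
        refine ENNReal.tendsto_ofReal ?_
        simpa using tendsto_const_nhds.sub
          ((tendsto_one_div_add_atTop_nhds_zero_nat (𝕜 := ℝ)).const_mul 2)
    _ ≤ Filter.liminf (fun n : ℕ => ∫⁻ ω,
          ENNReal.ofReal (‖g ω‖ - 2 * (1 / ((n : ℝ) + 1))) ^ (p : ℝ) ∂μ) Filter.atTop :=
        lintegral_liminf_le fun n => hmeas _
    _ ≤ Filter.liminf (fun _ : ℕ => B) Filter.atTop :=
        Filter.liminf_le_liminf (Filter.Eventually.of_forall fun n => step _ (by positivity))
    _ = B := Filter.liminf_const B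

theorem bochnerNorm_comp_le [IsFiniteMeasure μ] (hp : 1 ≤ p)
    (hu : SummingBound u p K) (hf : PDunfordIntegrable f p μ)
    (huf : AEStronglyMeasurable (fun ω => u (f ω)) μ) :
    bochnerNorm (fun ω => u (f ω)) p μ ≤ K * dunfordNorm f p μ := by
  have hp0 : 0 < (p : ℝ) := zero_lt_one.trans_le hp
  rw [bochnerNorm, one_div, ENNReal.rpow_inv_le_iff hp0]
  exact lintegral_enorm_rpow_le hp hu hf huf

end Integrals

end PSummingDunford

theorem theorem4p9 {Ω X Y : Type*} [MeasurableSpace Ω]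
    (μ : Measure Ω) [IsProbabilityMeasure μ] [μ.IsComplete]
    [NormedAddCommGroup X] [NormedSpace ℝ X] [CompleteSpace X]
    [NormedAddCommGroup Y] [NormedSpace ℝ Y] [CompleteSpace Y]
    (p : ℝ≥0) (hp : 1 ≤ p)
    (u : X →L[ℝ] Y) (hu : PSummingDunford.PSumming u p)
    (f : Ω → X) (hf : PSummingDunford.PDunfordIntegrable f p μ)
    (huf : AEStronglyMeasurable (fun ω => u (f ω)) μ) :
    PSummingDunford.PBochnerIntegrable (fun ω => u (f ω)) p μ ∧
      PSummingDunford.bochnerNorm (fun ω => u (f ω)) p μ ≤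
        (PSummingDunford.summingNorm u p : ℝ≥0∞) * PSummingDunford.dunfordNorm f p μ := by
  have hD := hf.dunfordNorm_ne_top hp
  constructor
  · obtain ⟨K, hK⟩ := hu
    refine ⟨huf, huf.norm, ?_⟩
    rw [eLpNorm_norm, PSummingDunford.eLpNorm_coe_eq hp]
    exact (PSummingDunford.bochnerNorm_comp_le hp hK hf huf).trans_lt
      (ENNReal.mul_lt_top ENNReal.coe_lt_top hD.lt_top)
  · have hne : Set.Nonempty {K : ℝ≥0 | PSummingDunford.SummingBound u p K} := hu
    rcases eq_or_ne (PSummingDunford.dunfordNorm f p μ) 0 with h0 | h0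
    · obtain ⟨K, hK⟩ := hu
      simpa [h0] using PSummingDunford.bochnerNorm_comp_le hp hK hf huf
    -- Dividing by the Dunford norm, nonzero and finite here, lets the infimum over `K` be taken
    -- directly.
    rw [← ENNReal.div_le_iff h0 hD, PSummingDunford.summingNorm, ENNReal.coe_sInf hne]
    refine le_iInf₂ fun K hK => ?_
    rw [ENNReal.div_le_iff h0 hD]
    exact PSummingDunford.bochnerNorm_comp_le hp hK hf huf
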